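/- Let $k>0$ and $\lambda\in\mathbb R$, $\lambda\neq 0$. For $w\in\mathbb C$ let $z\mapsto E_k(z,w)$ be the one-dimensional Dunkl kernel, i.e. the unique entire function $f$ with $f(0)=1$ and $$f'(z)+k\,\frac{f(z)-f(-z)}{z}=w\,f(z)\qquad(z\neq0),$$ and put $c_k:=\frac{1}{2^{k+1/2}\,\Gamma(k+1/2)}$. A one-dimensional Dunkl process with multiplicity $k$, drift $\lambda$ and start in $0$ is a real-valued Markov process $(X_t)_{t\ge0}$ with $X_0=0$ almost surely whose transition kernels are, for $t>0$, $x\in\mathbb R$ and Borel sets $A\subset\mathbb R$, $$K_t(x,A)=\frac{c_k\,e^{-\lambda^2t/2}}{t^{k+1/2}}\int_A e^{-(x^2+y^2)/(2t)}\,\frac{E_k\big(\tfrac{x}{\sqrt t},\tfrac{y}{\sqrt t}\big)\,E_k(y,\lambda)}{E_k(x,\lambda)}\,|y|^{2k}\,dy .$$ Theorem. Let $(X_t)_{t\ge0}$ be a one-dimensional Dunkl process with multiplicity $k>0$, drift $\lambda\ne0$ and start in $0$. Then $(X_t-t\lambda)/\sqrt t$ converges in distribution to the standard normal distribution $N(0,1)$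 as $t\to\infty$. Moreover, for every $t>0$ the random variable $(X_t-t\lambda)/\sqrt t$ has the Lebesgue density $$\phi_t(y)=c_k\,\frac{e^{-\lambda^2t/2}}{t^{k}}\,e^{-(y\sqrt t+\lambda t)^2/(2t)}\,E_k(y\sqrt t+\lambda t,\lambda)\,|y\sqrt t+\lambda t|^{2k}\qquad(y\in\mathbb R),$$ and $\phi_t(y)\to\frac1{\sqrt{2\pi}}e^{-y^2/2}$ as $t\to\infty$, locally uniformly in $y\in\mathbb R$. -/

import Mathlib

open MeasureTheory ProbabilityTheory Filter Topology
open scoped NNReal ENNReal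

noncomputable section

/-- The rank-one Dunkl operator `T(k)` of the root system `{1, -1}` (positive root `1`,
reflection `z ↦ -z`), acting on functions of one complex variable; evaluated at `z ≠ 0`. -/
def dunklOperator (k : ℝ) (f : ℂ → ℂ) (z : ℂ) : ℂ :=
  deriv f z + (k : ℂ) * ((f z - f (-z)) / z)

/-- `f` is a holomorphic solution of the eigenvalue problem `T(k) f = w f`, `f 0 = 1`
(at `z = 0` the equation holds by continuity). -/
structure IsDunklEigenfunction (k : ℝ) (w : ℂ) (f : ℂ → ℂ) : Prop where
  entire : Differentiable ℂ f
  eigen : ∀ z : ℂ, z ≠ 0 → dunklOperator k f z = w * f z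
  at_zero : f 0 = 1

/-- Two solutions of the eigenvalue problem agree. -/
theorem IsDunklEigenfunction.unique {k : ℝ} (hk : 0 ≤ k) {w : ℂ} {f g : ℂ → ℂ}
    (hf : IsDunklEigenfunction k w f) (hg : IsDunklEigenfunction k w g) : f = g := by
  have hd : Differentiable ℂ (fun z => f z - g z) := hf.entire.sub hg.entire
  have hall : AnalyticOnNhd ℂ (fun z => f z - g z) Set.univ := fun z _ => hd.analyticAt z
  have hfa : AnalyticOnNhd ℂ f Set.univ := fun z _ => hf.entire.analyticAt z
  have hga : AnalyticOnNhd ℂ g Set.univ := fun z _ => hg.entire.analyticAt z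
  by_contra hne
  have h0 : ¬ (∀ᶠ z in 𝓝 (0 : ℂ), f z - g z = 0) := by
    intro h
    exact hne (hfa.eq_of_eventuallyEq hga (h.mono fun z hz => sub_eq_zero.mp hz))
  obtain ⟨n, u, hu, hu0, hue⟩ :=
    (hall 0 (Set.mem_univ _)).exists_eventuallyEq_pow_smul_nonzero_iff.mpr h0
  simp only [sub_zero, smul_eq_mul] at hue
  have hn : n ≠ 0 := by
    rintro rfl
    have := hue.self_of_nhds
    simp [hf.at_zero, hg.at_zero] at this
    exact hu0 this.symm
  obtain ⟨m, rfl⟩ := Nat.exists_eq_add_one_of_ne_zero hn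
  -- the equation near zero
  have hderiv : ∀ᶠ z in 𝓝 (0 : ℂ), deriv (fun z => f z - g z) z
      = ((m + 1 : ℕ) : ℂ) * z ^ m * u z + z ^ (m + 1) * deriv u z := by
    filter_upwards [hue.eventually_nhds, hu.eventually_analyticAt] with z hz hza
    have hz' : (fun z => f z - g z) =ᶠ[𝓝 z] fun z => z ^ (m + 1) * u z := hz
    rw [hz'.deriv_eq]
    have h1 := (hasDerivAt_pow (m + 1) z).mul hza.differentiableAt.hasDerivAt
    have h2 : deriv (fun z => z ^ (m + 1) * u z) z
        = ((m + 1 : ℕ) : ℂ) * z ^ (m + 1 - 1) * u z + z ^ (m + 1) * deriv u z := h1.deriv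
    simpa using h2
  have hneg : Tendsto (fun z : ℂ => -z) (𝓝 0) (𝓝 0) := by
    simpa using (continuous_neg (G := ℂ)).tendsto 0
  have key : ∀ᶠ z in 𝓝[≠] (0 : ℂ),
      ((m + 1 : ℕ) : ℂ) * u z + z * deriv u z + k * (u z - (-1) ^ (m + 1) * u (-z))
        - w * z * u z = 0 := by
    filter_upwards [hderiv.filter_mono nhdsWithin_le_nhds, hue.filter_mono nhdsWithin_le_nhds,
      (hneg.eventually hue).filter_mono nhdsWithin_le_nhds, self_mem_nhdsWithin]
      with z h1 h2 h3 hz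
    have hz0 : z ≠ 0 := hz
    have e1 := hf.eigen z hz0
    have e2 := hg.eigen z hz0
    have hds : deriv (fun z => f z - g z) z = deriv f z - deriv g z :=
      deriv_fun_sub hf.entire.differentiableAt hg.entire.differentiableAt
    rw [hds] at h1
    unfold dunklOperator at e1 e2
    have e3 : (deriv f z - deriv g z) * z + k * ((f z - g z) - (f (-z) - g (-z)))
        = w * z * (f z - g z) := by
      field_simp at e1 e2
      linear_combination e1 - e2
    rw [h1, h2, h3, neg_pow z] at e3
    have hzm : z ^ (m + 1) ≠ 0 := pow_ne_zero _ hz0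
    apply mul_left_cancel₀ hzm
    rw [mul_zero]
    linear_combination e3
  have hcont : ContinuousAt (fun z : ℂ => ((m + 1 : ℕ) : ℂ) * u z + z * deriv u z
      + k * (u z - (-1) ^ (m + 1) * u (-z)) - w * z * u z) 0 := by
    have c1 : ContinuousAt u 0 := hu.continuousAt
    have c2 : ContinuousAt (deriv u) 0 := hu.deriv.continuousAt
    have c3 : ContinuousAt (fun z => u (-z)) 0 :=
      ContinuousAt.comp (by simpa using c1) continuous_neg.continuousAt
    exact (((continuousAt_const.mul c1).add (continuousAt_id.mul c2)).add
      (continuousAt_const.mul (c1.sub (continuousAt_const.mul c3)))).sub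
      ((continuousAt_const.mul continuousAt_id).mul c1)
  have hlim := (hcont.tendsto.mono_left nhdsWithin_le_nhds).congr' key
  have hz := tendsto_nhds_unique hlim tendsto_const_nhds
  simp only [neg_zero, zero_mul, mul_zero, add_zero, sub_zero] at hz
  have hfac : (((m + 1 : ℕ) : ℂ) + k * (1 - (-1) ^ (m + 1))) * u 0 = 0 := by
    linear_combination hz
  rcases mul_eq_zero.mp hfac with h | h
  · have hr : (((m + 1 : ℕ) : ℝ) + k * (1 - (-1) ^ (m + 1))) = 0 := by
      exact_mod_cast h
    have hp : (0 : ℝ) ≤ 1 - (-1) ^ (m + 1) := by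
      rcases neg_one_pow_eq_or ℝ (m + 1) with h | h <;> rw [h] <;> norm_num
    have : (0 : ℝ) < ((m + 1 : ℕ) : ℝ) := by positivity
    nlinarith [mul_nonneg hk hp]
  · exact hu0 h

/-- The recursively defined Taylor coefficients of the solution of the eigenvalue problem. -/
def dunklCoeff (k : ℝ) (w : ℂ) : ℕ → ℂ
  | 0 => 1
  | n + 1 => w / (((n + 1 : ℕ) : ℂ) + k * (1 - (-1) ^ (n + 1))) * dunklCoeff k w n

theorem dunklCoeff_norm_le {k : ℝ} (hk : 0 ≤ k) (w : ℂ) (n : ℕ) :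
    ‖dunklCoeff k w n‖ ≤ ‖w‖ ^ n / n.factorial := by
  induction n with
  | zero => simp [dunklCoeff]
  | succ n ih =>
    have hp : (0 : ℝ) ≤ 1 - (-1) ^ (n + 1) := by
      rcases neg_one_pow_eq_or ℝ (n + 1) with h | h <;> rw [h] <;> norm_num
    have hge : ((n + 1 : ℕ) : ℝ) ≤ ((n + 1 : ℕ) : ℝ) + k * (1 - (-1) ^ (n + 1)) := by
      nlinarith [mul_nonneg hk hp]
    have hpos : (0 : ℝ) < ((n + 1 : ℕ) : ℝ) := by positivity
    have hnorm : ‖(((n + 1 : ℕ) : ℂ) + k * (1 - (-1) ^ (n + 1)))‖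
        = ((n + 1 : ℕ) : ℝ) + k * (1 - (-1) ^ (n + 1)) := by
      have hc : (((n + 1 : ℕ) : ℂ) + k * (1 - (-1) ^ (n + 1)))
          = (((((n + 1 : ℕ) : ℝ) + k * (1 - (-1) ^ (n + 1)) : ℝ)) : ℂ) := by push_cast; ring
      rw [hc, Complex.norm_real, Real.norm_of_nonneg (hpos.le.trans hge)]
    rw [dunklCoeff, norm_mul, norm_div, hnorm]
    calc ‖w‖ / (((n + 1 : ℕ) : ℝ) + k * (1 - (-1) ^ (n + 1))) * ‖dunklCoeff k w n‖
        ≤ ‖w‖ / ((n + 1 : ℕ) : ℝ) * (‖w‖ ^ n / n.factorial) := by gcongr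
      _ = ‖w‖ ^ (n + 1) / (n + 1).factorial := by
        rw [Nat.factorial_succ]; push_cast; field_simp; ring

/-- The eigenvalue problem has a holomorphic solution, given by its Taylor series. -/
theorem isDunklEigenfunction_tsum {k : ℝ} (hk : 0 ≤ k) (w : ℂ) :
    IsDunklEigenfunction k w (fun z => ∑' n : ℕ, dunklCoeff k w n * z ^ n) := by
  have hsumm : ∀ R : ℝ, Summable fun n : ℕ => ‖dunklCoeff k w n‖ * |R| ^ n := by
    intro R
    refine Summable.of_nonneg_of_le (fun n => by positivity) (fun n => ?_)
      (Real.summable_pow_div_factorial (‖w‖ * |R|))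
    rw [mul_pow]
    calc ‖dunklCoeff k w n‖ * |R| ^ n ≤ ‖w‖ ^ n / n.factorial * |R| ^ n := by
          gcongr; exact dunklCoeff_norm_le hk w n
      _ = _ := by ring
  have hbound : ∀ R : ℝ, ∀ (n : ℕ) (z : ℂ), z ∈ Metric.ball (0 : ℂ) R →
      ‖dunklCoeff k w n * z ^ n‖ ≤ ‖dunklCoeff k w n‖ * |R| ^ n := by
    intro R n z hz
    rw [norm_mul, norm_pow]
    have : ‖z‖ ≤ |R| := (mem_ball_zero_iff.mp hz).le.trans (le_abs_self R)
    gcongr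
  have hdiff : ∀ R : ℝ, ∀ n : ℕ,
      DifferentiableOn ℂ (fun z : ℂ => dunklCoeff k w n * z ^ n) (Metric.ball 0 R) := by
    intro R n; fun_prop
  have hser : ∀ z : ℂ, HasSum (fun n : ℕ => dunklCoeff k w n * z ^ n)
      (∑' n : ℕ, dunklCoeff k w n * z ^ n) := by
    intro z
    refine (Summable.of_norm_bounded (hsumm (‖z‖ + 1)) fun n => ?_).hasSum
    exact hbound _ n z (by simp)
  refine ⟨fun z => ?_, fun z hz => ?_, ?_⟩
  · have hz : z ∈ Metric.ball (0 : ℂ) (‖z‖ + 1) := by simp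
    exact (Complex.differentiableOn_tsum_of_summable_norm (hsumm (‖z‖ + 1)) (hdiff _)
      Metric.isOpen_ball (hbound _)).differentiableAt (Metric.isOpen_ball.mem_nhds hz)
  · have hzb : z ∈ Metric.ball (0 : ℂ) (‖z‖ + 1) := by simp
    have h1 := Complex.hasSum_deriv_of_summable_norm (hsumm (‖z‖ + 1)) (hdiff _)
      Metric.isOpen_ball (hbound _) hzb
    have h2 := (((hser z).sub (hser (-z))).div_const z).mul_left (k : ℂ)
    have h3 := h1.add h2
    have h4 := (hser z).mul_left w
    unfold dunklOperator
    rw [← hasSum_nat_add_iff' 1] at h3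
    simp only [Finset.range_one, Finset.sum_singleton, pow_zero, mul_one, sub_self, zero_div,
      mul_zero, add_zero, deriv_const', sub_zero] at h3
    refine h3.unique ?_
    refine (congrArg (fun g : ℕ → ℂ => HasSum g _) (funext fun n => ?_)).mpr h4
    have hden : (((n + 1 : ℕ) : ℂ) + k * (1 - (-1) ^ (n + 1))) ≠ 0 := by
      have hp : (0 : ℝ) ≤ 1 - (-1) ^ (n + 1) := by
        rcases neg_one_pow_eq_or ℝ (n + 1) with h | h <;> rw [h] <;> norm_num
      have hpos : (0 : ℝ) < ((n + 1 : ℕ) : ℝ) := by positivity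
      have : (((n + 1 : ℕ) : ℝ) + k * (1 - (-1) ^ (n + 1))) ≠ 0 := by
        nlinarith [mul_nonneg hk hp]
      exact_mod_cast this
    have hc : dunklCoeff k w (n + 1) * (((n + 1 : ℕ) : ℂ) + k * (1 - (-1) ^ (n + 1)))
        = w * dunklCoeff k w n := by
      rw [dunklCoeff]; field_simp
    have hdv : deriv (fun z : ℂ => dunklCoeff k w (n + 1) * z ^ (n + 1)) z
        = dunklCoeff k w (n + 1) * (((n + 1 : ℕ) : ℂ) * z ^ n) := by
      simp
    rw [hdv, neg_pow z]
    have : (k : ℂ) * ((dunklCoeff k w (n + 1) * z ^ (n + 1)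
        - dunklCoeff k w (n + 1) * ((-1) ^ (n + 1) * z ^ (n + 1))) / z)
        = dunklCoeff k w (n + 1) * (k * (1 - (-1) ^ (n + 1))) * z ^ n := by
      field_simp; ring
    rw [this]
    linear_combination z ^ n * hc
  · rw [tsum_eq_single 0 (by intro n hn; simp [hn])]
    simp [dunklCoeff]

/-- The Dunkl kernel `E_k(z, w)`: the function `z ↦ E_k(z, w)` is the holomorphic solution `f` of
`T(k) f = w f`, `f 0 = 1`. -/
def dunklKernel (k : ℝ) (z w : ℂ) : ℂ :=
  Classical.epsilon (IsDunklEigenfunction k w) z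

/-- For `k ≥ 0` the Dunkl kernel does solve the eigenvalue problem. -/
theorem isDunklEigenfunction_dunklKernel {k : ℝ} (hk : 0 ≤ k) (w : ℂ) :
    IsDunklEigenfunction k w (fun z => dunklKernel k z w) :=
  Classical.epsilon_spec ⟨_, isDunklEigenfunction_tsum hk w⟩

/-- The Dunkl kernel on `ℝ × ℝ`, where its values are real. -/
def dunklKernelReal (k x y : ℝ) : ℝ := (dunklKernel k (x : ℂ) (y : ℂ)).re

/-- The normalization constant `c_k = 1 / (2^(k + 1/2) Γ(k + 1/2))`. -/
def dunklConst (k : ℝ) : ℝ := 1 / ((2 : ℝ) ^ (k + 1 / 2) * Real.Gamma (k + 1 / 2))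

/-- The Lebesgue density `y ↦ p_t(x, y)`, `t > 0`, of the transition kernel of the one-dimensional
Dunkl process with multiplicity `k` and drift `lam`; the weight is `w_k(y) = |y|^(2k)`. -/
def dunklTransitionDensity (k lam t x y : ℝ) : ℝ :=
  dunklConst k * Real.exp (-(lam ^ 2 * t / 2)) / t ^ (k + 1 / 2)
    * Real.exp (-(x ^ 2 + y ^ 2) / (2 * t))
    * (dunklKernelReal k (x / √t) (y / √t) * dunklKernelReal k y lam / dunklKernelReal k x lam)
    * |y| ^ (2 * k)

/-- The transition kernel `K_t(x, ·)`, `t > 0`. -/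
def dunklTransition (k lam t x : ℝ) : Measure ℝ :=
  volume.withDensity fun y => ENNReal.ofReal (dunklTransitionDensity k lam t x y)

/-- `X` is a one-dimensional Dunkl process with multiplicity `k`, drift `lam` and start in `x₀`:
a Markov process (with respect to its own filtration) with transition kernels `K_t`. -/
structure IsDunklProcess {Ω : Type*} [MeasurableSpace Ω] (P : Measure Ω) (k lam x₀ : ℝ)
    (X : ℝ≥0 → Ω → ℝ) : Prop where
  measurable : ∀ t, Measurable (X t)
  start : ∀ᵐ ω ∂P, X 0 ω = x₀
  markov : ∀ s t : ℝ≥0, s < t → ∀ A : Set ℝ, MeasurableSet A →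
    P[(X t ⁻¹' A).indicator (fun _ => (1 : ℝ)) |
        Filtration.natural X (fun u => (measurable u).stronglyMeasurable) s]
      =ᵐ[P] fun ω => (dunklTransition k lam ((t : ℝ) - (s : ℝ)) (X s ω) A).toReal

/-- The explicit density `φ_t` of `(X_t - t lam) / √t` for the process started in `0`. -/
def dunklNormalizedDensity (k lam t y : ℝ) : ℝ :=
  dunklConst k * Real.exp (-(lam ^ 2 * t / 2)) / t ^ k
    * Real.exp (-(y * √t + lam * t) ^ 2 / (2 * t))
    * dunklKernelReal k (y * √t + lam * t) lam
    * |y * √t + lam * t| ^ (2 * k)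

end

/-! The law of `X t` comes from the Markov property at time `0`. Since `E_k(0, ·) = 1`, an affine
change of variables gives `φ_t`.

For the asymptotics, uniqueness for the eigenvalue problem identifies `E_k(x, y)` with a constant
times `∫ (1-u)^(k-1) (1+u)^k e^(xyu) du` over `(-1, 1)`. As `xy → +∞` the mass concentrates at `u =
1`, and Watson's lemma gives `E_k(x, y) ~ const · e^(xy) (xy)^(-k)`. Put `z = y√t + λt`. Then `zλ →
+∞` for either sign of `λ`, the three exponentials combine to `e^(-y²/2)`, the powers reduce to
`(|z| / (t|λ|))^k → 1`, and the constants to `1/√(2π)`.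

Taking the limit jointly in `(t, y)` makes it locally uniform (`tendsto_dunklNormalizedDensity`).
Convergence of densities gives weak convergence by Fatou and the portmanteau theorem. -/

/-! ### Integral representation of the Dunkl kernel -/

/-- The weight `(1 - u²)^(k - 1)` on `(-1, 1)`, in factored form. -/
noncomputable def jacobiWeight (k u : ℝ) : ℝ := (1 - u) ^ (k - 1) * (1 + u) ^ (k - 1)

theorem jacobiWeight_neg (k u : ℝ) : jacobiWeight k (-u) = jacobiWeight k u := by
  simp only [jacobiWeight, sub_neg_eq_add, ← sub_eq_add_neg]
  ring

/-- For `k < 1` both endpoints are singular. On `[0, 1]` only the factor `1 - u` can be; evenness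
carries the result to `[-1, 0]`. -/
theorem intervalIntegrable_jacobiWeight {k : ℝ} (hk : 0 < k) :
    IntervalIntegrable (jacobiWeight k) volume (-1) 1 := by
  have h01 : IntervalIntegrable (jacobiWeight k) volume 0 1 := by
    have h := ((intervalIntegral.intervalIntegrable_rpow' (a := 0) (b := 1)
      (show -1 < k - 1 by linarith)).comp_sub_left 1).symm
    simp only [sub_zero, sub_self] at h
    refine h.mul_continuousOn ?_
    intro u hu
    rw [Set.uIcc_of_le zero_le_one] at hu
    have : (1 + u) ≠ 0 := by have := hu.1; positivity
    exact ((continuousAt_const.add continuousAt_id).rpow_const (Or.inl this)).continuousWithinAt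
  have hneg := (IntervalIntegrable.iff_comp_neg).mp h01
  simp only [neg_zero, jacobiWeight_neg] at hneg
  exact hneg.symm.trans h01

theorem intervalIntegrable_jacobiWeight_mul {k : ℝ} (hk : 0 < k) {g : ℝ → ℂ}
    (hg : Continuous g) :
    IntervalIntegrable (fun u => (jacobiWeight k u : ℂ) * g u) volume (-1) 1 :=
  IntervalIntegrable.mul_continuousOn (intervalIntegrable_iff.mpr
    (intervalIntegrable_iff.mp (intervalIntegrable_jacobiWeight hk)).ofReal) hg.continuousOn

/-- The unnormalized Laplace-type integral representing the Dunkl kernel. -/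
noncomputable def dunklIntegral (k : ℝ) (w z : ℂ) : ℂ :=
  ∫ u in (-1 : ℝ)..1, (jacobiWeight k u : ℂ) * ((1 + (u : ℂ)) * Complex.exp (w * z * u))

theorem hasDerivAt_dunklIntegral {k : ℝ} (hk : 0 < k) (w z : ℂ) :
    HasDerivAt (dunklIntegral k w)
      (∫ u in (-1 : ℝ)..1,
        (jacobiWeight k u : ℂ) * ((1 + (u : ℂ)) * (w * u * Complex.exp (w * z * u)))) z := by
  have hu1 : ∀ u : ℝ, u ∈ Set.uIoc (-1 : ℝ) 1 → |u| ≤ 1 := by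
    intro u hu
    rw [Set.uIoc_of_le (by norm_num)] at hu
    exact abs_le.mpr ⟨hu.1.le, hu.2⟩
  refine (intervalIntegral.hasDerivAt_integral_of_dominated_loc_of_deriv_le
    (F := fun z u => (jacobiWeight k u : ℂ) * ((1 + (u : ℂ)) * Complex.exp (w * z * u)))
    (F' := fun z u => (jacobiWeight k u : ℂ) * ((1 + (u : ℂ)) * (w * u * Complex.exp (w * z * u))))
    -- For `y` in the unit ball around `z` and `|u| ≤ 1`: `‖1 + u‖ ≤ 2` and `‖w y u‖ ≤ ‖w‖ (‖z‖ +
    -- 1)`.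
    (bound := fun u => ‖jacobiWeight k u‖ * (2 * (‖w‖ * Real.exp (‖w‖ * (‖z‖ + 1)))))
    (Metric.ball_mem_nhds z one_pos) ?_ ?_ ?_ ?_ ?_ ?_).2
  · refine Eventually.of_forall fun y => ?_
    exact (intervalIntegrable_iff.mp
      (intervalIntegrable_jacobiWeight_mul hk (by fun_prop))).aestronglyMeasurable
  · exact intervalIntegrable_jacobiWeight_mul hk (by fun_prop)
  · exact (intervalIntegrable_iff.mp
      (intervalIntegrable_jacobiWeight_mul hk (by fun_prop))).aestronglyMeasurable
  · refine Eventually.of_forall fun u hu y hy => ?_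
    have hu' := hu1 u hu
    have hy' : ‖y‖ ≤ ‖z‖ + 1 := by
      have h1 : ‖y - z‖ < 1 := mem_ball_iff_norm.mp hy
      have h2 := norm_le_norm_add_norm_sub' y z
      linarith
    rw [norm_mul, Complex.norm_real, norm_mul, norm_mul, norm_mul, Complex.norm_real,
      Real.norm_eq_abs u]
    have h1 : ‖1 + (u : ℂ)‖ ≤ 2 := by
      refine (norm_add_le _ _).trans ?_
      rw [Complex.norm_real, norm_one, Real.norm_eq_abs]
      linarith
    have h2 : ‖Complex.exp (w * y * u)‖ ≤ Real.exp (‖w‖ * (‖z‖ + 1)) := by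
      refine (Complex.norm_exp_le_exp_norm _).trans (Real.exp_le_exp.mpr ?_)
      rw [norm_mul, norm_mul, Complex.norm_real, Real.norm_eq_abs]
      calc ‖w‖ * ‖y‖ * |u| ≤ ‖w‖ * ‖y‖ * 1 := by gcongr
        _ ≤ ‖w‖ * (‖z‖ + 1) := by rw [mul_one]; gcongr
    have h3 : ‖w‖ * |u| ≤ ‖w‖ := mul_le_of_le_one_right (norm_nonneg _) hu'
    gcongr
  · exact (intervalIntegrable_jacobiWeight hk).norm.mul_const _
  · refine Eventually.of_forall fun u _ y _ => ?_
    have h : HasDerivAt (fun y : ℂ => w * y * u) (w * u) y := by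
      simpa using ((hasDerivAt_id y).const_mul w).mul_const (u : ℂ)
    convert! (h.cexp.const_mul (1 + (u : ℂ))).const_mul (jacobiWeight k u : ℂ) using 1
    ring

/-- The integrand is the derivative of `(1 - u²)^k e^(au)`, which vanishes at `±1` because `k > 0`.
Differentiability is needed only in the open interval. -/
theorem integral_jacobiWeight_by_parts {k : ℝ} (hk : 0 < k) (a : ℂ) :
    ∫ u in (-1 : ℝ)..1, (jacobiWeight k u : ℂ) *
      ((a * (1 - (u : ℂ) ^ 2) - 2 * k * u) * Complex.exp (a * u)) = 0 := by
  have hsplit : ∀ u ∈ Set.Ioo (-1 : ℝ) 1, 0 < 1 - u ∧ 0 < 1 + u :=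
    fun u hu => ⟨by linarith [hu.2], by linarith [hu.1]⟩
  have h := intervalIntegral.integral_eq_sub_of_hasDerivAt_of_le
    (f := fun u : ℝ => (((1 - u) ^ k * (1 + u) ^ k : ℝ) : ℂ) * Complex.exp (a * u))
    (f' := fun u : ℝ => (jacobiWeight k u : ℂ) *
      ((a * (1 - (u : ℂ) ^ 2) - 2 * k * u) * Complex.exp (a * u)))
    (show (-1 : ℝ) ≤ 1 by norm_num) ?_ ?_
    (intervalIntegrable_jacobiWeight_mul hk (by fun_prop))
  · rw [h]
    simp [Real.zero_rpow hk.ne']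
  · refine Continuous.continuousOn ?_
    refine (Complex.continuous_ofReal.comp ?_).mul (by fun_prop)
    exact ((continuous_const.sub continuous_id).rpow_const fun _ => Or.inr hk.le).mul
      ((continuous_const.add continuous_id).rpow_const fun _ => Or.inr hk.le)
  · intro u hu
    obtain ⟨hm, hp⟩ := hsplit u hu
    have h1 : HasDerivAt (fun u : ℝ => (1 - u) ^ k * (1 + u) ^ k)
        (jacobiWeight k u * (-2 * k * u)) u := by
      have e1 := ((hasDerivAt_id u).const_sub 1).rpow_const (p := k) (Or.inl hm.ne')
      have e2 := ((hasDerivAt_id u).const_add 1).rpow_const (p := k) (Or.inl hp.ne')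
      convert! e1.mul e2 using 1
      simp only [id, jacobiWeight]
      have m1 : (1 - u) ^ k = (1 - u) * (1 - u) ^ (k - 1) := by
        rw [Real.rpow_sub_one hm.ne']; field_simp
      have p1 : (1 + u) ^ k = (1 + u) * (1 + u) ^ (k - 1) := by
        rw [Real.rpow_sub_one hp.ne']; field_simp
      rw [m1, p1]
      ring
    have h2 : HasDerivAt (fun u : ℝ => Complex.exp (a * u)) (Complex.exp (a * u) * a) u := by
      have h3 : HasDerivAt (fun u : ℝ => a * (u : ℂ)) a u := by
        simpa using (Complex.ofRealCLM.hasDerivAt (x := u)).const_mul a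
      exact h3.cexp
    convert! h1.ofReal_comp.mul h2 using 1
    have hw : ((1 - u) ^ k * (1 + u) ^ k : ℝ) = jacobiWeight k u * (1 - u ^ 2) := by
      rw [jacobiWeight, Real.rpow_sub_one hm.ne', Real.rpow_sub_one hp.ne']
      field_simp
      ring
    rw [hw]
    push_cast
    ring

/-- The reflection `u ↦ -u` restores the exponential `e^(wzu)`, so that the values at `z` and `-z`
can be subtracted under one integral. -/
theorem dunklIntegral_neg (k : ℝ) (w z : ℂ) :
    dunklIntegral k w (-z) = ∫ u in (-1 : ℝ)..1,
      (jacobiWeight k u : ℂ) * ((1 - (u : ℂ)) * Complex.exp (w * z * u)) := by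
  have h := intervalIntegral.integral_comp_neg (a := -1) (b := 1) fun u : ℝ =>
    (jacobiWeight k u : ℂ) * ((1 - (u : ℂ)) * Complex.exp (w * z * u))
  rw [neg_neg] at h
  rw [← h, dunklIntegral]
  congr 1 with u
  rw [jacobiWeight_neg]
  push_cast
  ring_nf

/-- Under one integral, `T(k) f - w f` has the factor `w u (1+u) + 2ku/z - w (1+u) = -z⁻¹ (wz (1-u²)
- 2ku)`, whose integral vanishes by parts with `a = wz`. -/
theorem dunklOperator_dunklIntegral {k : ℝ} (hk : 0 < k) (w : ℂ) {z : ℂ} (hz : z ≠ 0) :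
    dunklOperator k (dunklIntegral k w) z = w * dunklIntegral k w z := by
  have hI : ∀ g : ℝ → ℂ, Continuous g →
      IntervalIntegrable (fun u => (jacobiWeight k u : ℂ) * g u) volume (-1) 1 :=
    fun g hg => intervalIntegrable_jacobiWeight_mul hk hg
  unfold dunklOperator
  rw [(hasDerivAt_dunklIntegral hk w z).deriv, dunklIntegral_neg]
  unfold dunklIntegral
  rw [← intervalIntegral.integral_sub (hI _ (by fun_prop)) (hI _ (by fun_prop)),
    ← intervalIntegral.integral_const_mul, ← sub_eq_zero]
  have hb := integral_jacobiWeight_by_parts hk (w * z)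
  have : (∫ u in (-1 : ℝ)..1, (jacobiWeight k u : ℂ) * ((1 + (u : ℂ)) * Complex.exp (w * z * u))
        - (jacobiWeight k u : ℂ) * ((1 - (u : ℂ)) * Complex.exp (w * z * u)))
      = ∫ u in (-1 : ℝ)..1, (jacobiWeight k u : ℂ) * (2 * u * Complex.exp (w * z * u)) := by
    congr 1 with u; ring
  rw [this, div_eq_inv_mul, ← mul_assoc, ← intervalIntegral.integral_const_mul]
  have e : ∀ u : ℝ, (k * z⁻¹ : ℂ) * ((jacobiWeight k u : ℂ) * (2 * u * Complex.exp (w * z * u)))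
      = (jacobiWeight k u : ℂ) * ((k * z⁻¹ : ℂ) * (2 * u * Complex.exp (w * z * u))) :=
    fun u => by ring
  have e' : ∀ u : ℝ, w * ((jacobiWeight k u : ℂ) * ((1 + u) * Complex.exp (w * z * u)))
      = (jacobiWeight k u : ℂ) * (w * ((1 + u) * Complex.exp (w * z * u))) :=
    fun u => by ring
  simp only [e, e']
  rw [← intervalIntegral.integral_add (hI _ (by fun_prop)) (hI _ (by fun_prop)),
    ← intervalIntegral.integral_sub ((hI _ (by fun_prop)).add (hI _ (by fun_prop)))
      (hI _ (by fun_prop))]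
  calc _ = ∫ u in (-1 : ℝ)..1, (-z⁻¹) * ((jacobiWeight k u : ℂ) *
      ((w * z * (1 - (u : ℂ) ^ 2) - 2 * k * u) * Complex.exp (w * z * u))) := by
        congr 1 with u; field_simp; ring
    _ = 0 := by rw [intervalIntegral.integral_const_mul, hb, mul_zero]

/-- The real form of the integral representation after the substitution `v = 1 - u`. -/
theorem dunklIntegral_ofReal {k : ℝ} (x y : ℝ) :
    dunklIntegral k x y =
      ((Real.exp (x * y) *
        ∫ v in Set.Ioo (0 : ℝ) 2, v ^ (k - 1) * (2 - v) ^ k * Real.exp (-(x * y * v)) : ℝ) : ℂ) := by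
  rw [← integral_const_mul, ← integral_Ioc_eq_integral_Ioo,
    ← intervalIntegral.integral_of_le zero_le_two]
  have h := intervalIntegral.integral_comp_sub_left (a := 0) (b := 2) (fun u : ℝ =>
    (jacobiWeight k u : ℂ) * ((1 + (u : ℂ)) * Complex.exp (x * y * u))) 1
  norm_num at h
  rw [dunklIntegral, ← h, ← intervalIntegral.integral_ofReal]
  refine intervalIntegral.integral_congr_ae ?_
  -- The null point `v = 2` is dropped: splitting `2 - v` off `(2 - v)^k` needs a nonzero base.
  have h2 : ∀ᵐ v : ℝ, v ≠ 2 := by simp [ae_iff]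
  filter_upwards [h2] with v hv2 hv
  rw [Set.uIoc_of_le zero_le_two] at hv
  have hv' : 0 < 2 - v := by have := lt_of_le_of_ne hv.2 hv2; linarith
  have e1 : jacobiWeight k (1 - v) = v ^ (k - 1) * (2 - v) ^ (k - 1) := by
    rw [jacobiWeight]; congr 2 <;> ring
  have e2 : (2 - v) ^ k = (2 - v) * (2 - v) ^ (k - 1) := by
    rw [Real.rpow_sub_one hv'.ne']; field_simp
  have e3 : Real.exp (x * y) * (v ^ (k - 1) * (2 - v) ^ k * Real.exp (-(x * y * v)))
      = v ^ (k - 1) * (2 - v) ^ (k - 1) * ((2 - v) * Real.exp (x * y * (1 - v))) := by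
    rw [e2, show x * y * (1 - v) = x * y + -(x * y * v) by ring, Real.exp_add]
    ring
  rw [e1, e3]
  push_cast
  ring

/-- This is `2^(2k) B(k, k+1) = 2^(2k) Γ(k) Γ(k+1) / Γ(2k+1)`, simplified by Legendre duplication at
`k + 1/2`. It fixes the normalization at `z = 0`. -/
theorem integral_rpow_mul_two_sub_rpow {k : ℝ} (hk : 0 < k) :
    ∫ v in Set.Ioo (0 : ℝ) 2, v ^ (k - 1) * (2 - v) ^ k
      = √Real.pi * Real.Gamma k / Real.Gamma (k + 1 / 2) := by
  have h := Complex.betaIntegral_scaled (k : ℂ) ((k + 1 : ℝ) : ℂ) (a := 2) two_pos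
  have hb := Complex.Gamma_mul_Gamma_eq_betaIntegral (s := (k : ℂ)) (t := ((k + 1 : ℝ) : ℂ))
    (by simpa) (by rw [Complex.ofReal_re]; linarith)
  have hd := Real.Gamma_mul_Gamma_add_half (k + 1 / 2)
  have hr : (∫ x in (0 : ℝ)..2, (x : ℂ) ^ ((k : ℂ) - 1) *
      (((2 : ℝ) : ℂ) - x) ^ (((k + 1 : ℝ) : ℂ) - 1))
      = ((∫ v in Set.Ioo (0 : ℝ) 2, v ^ (k - 1) * (2 - v) ^ k : ℝ) : ℂ) := by
    rw [← integral_Ioc_eq_integral_Ioo, ← intervalIntegral.integral_of_le zero_le_two,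
      ← intervalIntegral.integral_ofReal]
    refine intervalIntegral.integral_congr fun v hv => ?_
    rw [Set.uIcc_of_le zero_le_two] at hv
    have h2 : (0 : ℝ) ≤ 2 - v := by linarith [hv.2]
    push_cast
    rw [Complex.ofReal_cpow hv.1, Complex.ofReal_cpow h2]
    push_cast
    congr 2
    ring
  rw [hr] at h
  set I := ∫ v in Set.Ioo (0 : ℝ) 2, v ^ (k - 1) * (2 - v) ^ k with hIdef
  have hG : (Complex.Gamma (k : ℂ) * Complex.Gamma ((k + 1 : ℝ) : ℂ)) *
      ((2 : ℝ) : ℂ) ^ ((k : ℂ) + ((k + 1 : ℝ) : ℂ) - 1)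
        = Complex.Gamma ((k : ℂ) + ((k + 1 : ℝ) : ℂ)) * (I : ℂ) := by
    rw [h, hb]; ring
  have hG' : Real.Gamma k * Real.Gamma (k + 1) * (2 : ℝ) ^ (2 * k) = Real.Gamma (2 * k + 1) * I := by
    have e1 : (k : ℂ) + ((k + 1 : ℝ) : ℂ) = ((2 * k + 1 : ℝ) : ℂ) := by push_cast; ring
    rw [e1, show ((2 * k + 1 : ℝ) : ℂ) - 1 = ((2 * k : ℝ) : ℂ) by push_cast; ring,
      ← Complex.ofReal_cpow zero_le_two, Complex.Gamma_ofReal, Complex.Gamma_ofReal,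
      Complex.Gamma_ofReal] at hG
    exact_mod_cast hG
  rw [show k + 1 / 2 + 1 / 2 = k + 1 by ring, show 2 * (k + 1 / 2) = 2 * k + 1 by ring,
    show 1 - (2 * k + 1) = -(2 * k) by ring, Real.rpow_neg zero_le_two] at hd
  have p1 : 0 < Real.Gamma (k + 1 / 2) := Real.Gamma_pos_of_pos (by linarith)
  have p2 : 0 < Real.Gamma (2 * k + 1) := Real.Gamma_pos_of_pos (by linarith)
  have p3 : (0 : ℝ) < 2 ^ (2 * k) := by positivity
  rw [eq_div_iff p1.ne']
  apply mul_left_cancel₀ p2.ne'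
  have hd' : Real.Gamma (k + 1 / 2) * Real.Gamma (k + 1) * 2 ^ (2 * k)
      = Real.Gamma (2 * k + 1) * √Real.pi := by
    rw [hd, mul_right_comm, mul_assoc _ _ ((2 : ℝ) ^ (2 * k)), inv_mul_cancel₀ p3.ne', mul_one]
  linear_combination -Real.Gamma (k + 1 / 2) * hG' + Real.Gamma k * hd'

/-- The integral representation of the Dunkl kernel. -/
theorem dunklKernelReal_eq_integral {k : ℝ} (hk : 0 < k) (x y : ℝ) :
    dunklKernelReal k x y = Real.Gamma (k + 1 / 2) / (√Real.pi * Real.Gamma k) *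
      (Real.exp (x * y) *
        ∫ v in Set.Ioo (0 : ℝ) 2, v ^ (k - 1) * (2 - v) ^ k * Real.exp (-(x * y * v))) := by
  have p1 : 0 < Real.Gamma (k + 1 / 2) := Real.Gamma_pos_of_pos (by linarith)
  have p2 : 0 < Real.Gamma k := Real.Gamma_pos_of_pos hk
  set C : ℝ := Real.Gamma (k + 1 / 2) / (√Real.pi * Real.Gamma k) with hC
  have h0 : (C : ℂ) * dunklIntegral k y 0 = 1 := by
    have h := dunklIntegral_ofReal (k := k) y 0
    simp only [mul_zero, zero_mul, neg_zero, Real.exp_zero, mul_one, one_mul] at h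
    rw [integral_rpow_mul_two_sub_rpow hk] at h
    rw [← Complex.ofReal_zero, h, ← Complex.ofReal_mul, hC]
    have : √Real.pi ≠ 0 := by positivity
    norm_cast
    field_simp
  have hE : IsDunklEigenfunction k y (fun z => (C : ℂ) * dunklIntegral k y z) := by
    refine ⟨fun z => ((hasDerivAt_dunklIntegral hk y z).const_mul _).differentiableAt,
      fun z hz => ?_, h0⟩
    have h := dunklOperator_dunklIntegral hk y hz
    unfold dunklOperator at h ⊢
    rw [((hasDerivAt_dunklIntegral hk y z).const_mul (C : ℂ)).deriv,
      ← (hasDerivAt_dunklIntegral hk y z).deriv]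
    linear_combination (C : ℂ) * h
  have h := congrFun ((isDunklEigenfunction_dunklKernel hk.le (y : ℂ)).unique hk.le hE) (x : ℂ)
  rw [dunklKernelReal, h, dunklIntegral_ofReal, ← Complex.ofReal_mul, Complex.ofReal_re,
    mul_comm y x]

/-! ### Asymptotics of the integral for large argument -/

/-- Watson's lemma for the integral in `dunklKernelReal_eq_integral`. -/
theorem tendsto_rpow_mul_integral_exp_neg {k : ℝ} (hk : 0 < k) :
    Tendsto (fun a : ℝ => a ^ k *
        ∫ v in Set.Ioo (0 : ℝ) 2, v ^ (k - 1) * (2 - v) ^ k * Real.exp (-(a * v)))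
      atTop (𝓝 (2 ^ k * Real.Gamma k)) := by
  -- Substitute `v = s/a`. Truncating `2 - v` at `0` first extends the integral to `(0, ∞)`, so the
  -- domain does not depend on `a`.
  have hsub : ∀ a : ℝ, 0 < a → a ^ k *
        ∫ v in Set.Ioo (0 : ℝ) 2, v ^ (k - 1) * (2 - v) ^ k * Real.exp (-(a * v))
      = ∫ s in Set.Ioi (0 : ℝ), max (2 - a⁻¹ * s) 0 ^ k * (Real.exp (-s) * s ^ (k - 1)) := by
    intro a ha
    have h1 : ∫ v in Set.Ioo (0 : ℝ) 2, v ^ (k - 1) * (2 - v) ^ k * Real.exp (-(a * v))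
        = ∫ v in Set.Ioi (0 : ℝ), v ^ (k - 1) * max (2 - v) 0 ^ k * Real.exp (-(a * v)) := by
      rw [setIntegral_eq_of_subset_of_forall_sdiff_eq_zero measurableSet_Ioi
        Set.Ioo_subset_Ioi_self]
      · refine setIntegral_congr_fun measurableSet_Ioo fun v hv => ?_
        simp only [max_eq_left (sub_pos.mpr hv.2).le]
      · intro v hv
        have : 2 - v ≤ 0 := by
          by_contra! h
          exact hv.2 ⟨hv.1, by linarith⟩
        rw [max_eq_right this, Real.zero_rpow hk.ne', mul_zero, zero_mul]
    have h2 := integral_comp_mul_left_Ioi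
      (fun v : ℝ => v ^ (k - 1) * max (2 - v) 0 ^ k * Real.exp (-(a * v))) 0 (inv_pos.mpr ha)
    rw [mul_zero, inv_inv, smul_eq_mul] at h2
    have hak : a ^ k = a ^ (k - 1) * a := by rw [Real.rpow_sub_one ha.ne']; field_simp
    rw [h1, hak, mul_assoc, ← h2, ← integral_const_mul]
    refine setIntegral_congr_fun measurableSet_Ioi fun s hs => ?_
    have hs' : (0 : ℝ) < s := hs
    have e1 : a ^ (k - 1) * (a⁻¹ * s) ^ (k - 1) = s ^ (k - 1) := by
      rw [← Real.mul_rpow ha.le (by positivity), mul_inv_cancel_left₀ ha.ne']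
    simp only [mul_inv_cancel_left₀ ha.ne']
    rw [← e1]
    ring
  have hlim : Tendsto (fun a : ℝ =>
      ∫ s in Set.Ioi (0 : ℝ), max (2 - a⁻¹ * s) 0 ^ k * (Real.exp (-s) * s ^ (k - 1)))
      atTop (𝓝 (∫ s in Set.Ioi (0 : ℝ), 2 ^ k * (Real.exp (-s) * s ^ (k - 1)))) := by
    -- The truncated base lies in `[0, 2]`, so `2^k` times the Gamma integrand dominates; it is also
    -- the pointwise limit.
    refine tendsto_integral_filter_of_dominated_convergence
      (fun s => 2 ^ k * (Real.exp (-s) * s ^ (k - 1))) ?_ ?_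
      ((Real.GammaIntegral_convergent hk).const_mul _) ?_
    · refine Eventually.of_forall fun a => Measurable.aestronglyMeasurable (by fun_prop)
    · filter_upwards [eventually_gt_atTop 0] with a ha
      filter_upwards [ae_restrict_mem measurableSet_Ioi] with s hs
      have hs' : (0 : ℝ) < s := hs
      rw [Real.norm_of_nonneg (by positivity)]
      have : max (2 - a⁻¹ * s) 0 ≤ 2 := by
        have : 0 < a⁻¹ * s := by positivity
        exact max_le (by linarith) zero_le_two
      gcongr
    · refine Eventually.of_forall fun s => ?_
      have h : Tendsto (fun a : ℝ => max (2 - a⁻¹ * s) 0) atTop (𝓝 (max (2 - 0 * s) 0)) :=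
        (tendsto_const_nhds.sub (tendsto_inv_atTop_zero.mul_const s)).max tendsto_const_nhds
      rw [zero_mul, sub_zero, max_eq_left zero_le_two] at h
      exact (h.rpow_const (Or.inr hk.le)).mul_const _
  rw [integral_const_mul, ← Real.Gamma_eq_integral hk] at hlim
  refine hlim.congr' ?_
  filter_upwards [eventually_gt_atTop 0] with a ha
  exact (hsub a ha).symm

/-! ### Limit of the normalized density -/

/-- The normalized density as a perturbation of the Gaussian density. -/
theorem dunklNormalizedDensity_eq {k lam t y : ℝ} (hk : 0 < k) (hlam : lam ≠ 0) (ht : 0 < t)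
    (ha : 0 < (y * √t + lam * t) * lam) :
    dunklNormalizedDensity k lam t y = gaussianPDFReal 0 1 y *
      ((((y * √t + lam * t) * lam) ^ k * ∫ v in Set.Ioo (0 : ℝ) 2,
          v ^ (k - 1) * (2 - v) ^ k * Real.exp (-((y * √t + lam * t) * lam * v)))
        / (2 ^ k * Real.Gamma k)) *
      (|y * √t + lam * t| / (t * |lam|)) ^ k := by
  rw [dunklNormalizedDensity, dunklKernelReal_eq_integral hk]
  set z := y * √t + lam * t with hz
  set I := ∫ v in Set.Ioo (0 : ℝ) 2, v ^ (k - 1) * (2 - v) ^ k * Real.exp (-(z * lam * v))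
  have hz0 : 0 < |z| := abs_pos.mpr (left_ne_zero_of_mul ha.ne')
  have hl0 : 0 < |lam| := abs_pos.mpr hlam
  have p1 : 0 < Real.Gamma (k + 1 / 2) := Real.Gamma_pos_of_pos (by linarith)
  have p2 : 0 < Real.Gamma k := Real.Gamma_pos_of_pos hk
  -- Completing the square: `-λ²t/2 - z²/(2t) + zλ = -(z - λt)²/(2t) = -y²/2`.
  have hexp : Real.exp (-(lam ^ 2 * t / 2)) * Real.exp (-z ^ 2 / (2 * t)) * Real.exp (z * lam)
      = Real.exp (-(y - 0) ^ 2 / (2 * (1 : ℝ≥0))) := by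
    rw [← Real.exp_add, ← Real.exp_add]
    congr 1
    have hs : √t ^ 2 = t := Real.sq_sqrt ht.le
    rw [hz]
    push_cast
    field_simp
    linear_combination (-y ^ 2) * hs
  have e1 : (z * lam) ^ k = |z| ^ k * |lam| ^ k := by
    rw [← Real.mul_rpow (abs_nonneg _) (abs_nonneg _), ← abs_mul, abs_of_pos ha]
  have e2 : |z| ^ (2 * k) = |z| ^ k * |z| ^ k := by rw [two_mul, Real.rpow_add hz0]
  have e3 : (|z| / (t * |lam|)) ^ k = |z| ^ k / (t ^ k * |lam| ^ k) := by
    rw [Real.div_rpow (abs_nonneg _) (by positivity), Real.mul_rpow ht.le (abs_nonneg _)]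
  have e4 : (2 : ℝ) ^ (k + 1 / 2) = 2 ^ k * √2 := by
    rw [Real.rpow_add two_pos, Real.sqrt_eq_rpow]
  have e5 : √(2 * Real.pi * (1 : ℝ≥0)) = √2 * √Real.pi := by
    rw [NNReal.coe_one, mul_one, Real.sqrt_mul zero_le_two]
  rw [gaussianPDFReal, ← hexp, e1, e2, e3, e5, dunklConst, e4]
  have q1 : 0 < |lam| ^ k := Real.rpow_pos_of_pos hl0 _
  have q2 : 0 < t ^ k := Real.rpow_pos_of_pos ht _
  have q3 : (0 : ℝ) < √Real.pi := by positivity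
  generalize Real.Gamma (k + 1 / 2) = G at *
  generalize |lam| ^ k = l at *
  generalize t ^ k = T at *
  field_simp

/-- Both correction factors tend to `1` as `t → ∞` and `y → y₀` together. The joint limit, rather
than one for fixed `y`, is what local uniformity requires. -/
theorem tendsto_dunklNormalizedDensity {k lam : ℝ} (hk : 0 < k) (hlam : lam ≠ 0) (y₀ : ℝ) :
    Tendsto (fun q : ℝ × ℝ => dunklNormalizedDensity k lam q.1 q.2) (atTop ×ˢ 𝓝 y₀)
      (𝓝 (gaussianPDFReal 0 1 y₀)) := by
  have hs : Tendsto (fun q : ℝ × ℝ => √q.1) (atTop ×ˢ 𝓝 y₀) atTop :=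
    Real.tendsto_sqrt_atTop.comp tendsto_fst
  have hy : Tendsto (fun q : ℝ × ℝ => q.2) (atTop ×ˢ 𝓝 y₀) (𝓝 y₀) := tendsto_snd
  have ht : ∀ᶠ q : ℝ × ℝ in atTop ×ˢ 𝓝 y₀, 0 < q.1 :=
    tendsto_fst.eventually (eventually_gt_atTop 0)
  have hl2 : 0 < lam ^ 2 := by positivity
  have ha : Tendsto (fun q : ℝ × ℝ => (q.2 * √q.1 + lam * q.1) * lam) (atTop ×ˢ 𝓝 y₀) atTop := by
    -- Factor `zλ = √t (λ²√t + yλ)`; the sign of `λ` is irrelevant since only `λ²` leads.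
    have h := hs.atTop_mul_atTop₀ ((hs.const_mul_atTop hl2).atTop_add (hy.mul_const lam))
    refine h.congr' ?_
    filter_upwards [ht] with q hq
    linear_combination lam ^ 2 * Real.sq_sqrt hq.le
  have hr : Tendsto (fun q : ℝ × ℝ => |q.2 * √q.1 + lam * q.1| / (q.1 * |lam|))
      (atTop ×ˢ 𝓝 y₀) (𝓝 1) := by
    -- The ratio equals `|1 + (y/√t)/λ|`.
    have h := (((hy.div_atTop hs).div_const lam).const_add 1).abs
    rw [zero_div, add_zero, abs_one] at h
    refine h.congr' ?_
    filter_upwards [ht] with q hq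
    rw [show q.1 * |lam| = |q.1 * lam| by rw [abs_mul, abs_of_pos hq], ← abs_div]
    congr 1
    have hq' : √q.1 ≠ 0 := (Real.sqrt_pos.mpr hq).ne'
    have hq2 := Real.sq_sqrt hq.le
    field_simp
    linear_combination -q.2 * hq2
  have hg : Tendsto (fun q : ℝ × ℝ => gaussianPDFReal 0 1 q.2) (atTop ×ˢ 𝓝 y₀)
      (𝓝 (gaussianPDFReal 0 1 y₀)) :=
    (Continuous.tendsto (by unfold gaussianPDFReal; fun_prop) y₀).comp hy
  have hc : 2 ^ k * Real.Gamma k ≠ 0 := by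
    have := Real.Gamma_pos_of_pos hk
    positivity
  have h := (hg.mul (((tendsto_rpow_mul_integral_exp_neg hk).comp ha).div_const
    (2 ^ k * Real.Gamma k))).mul (hr.rpow_const (p := k) (Or.inr hk.le))
  rw [div_self hc, Real.one_rpow, mul_one, mul_one] at h
  refine h.congr' ?_
  filter_upwards [ht, ha.eventually_gt_atTop 0] with q hq hqa
  exact (dunklNormalizedDensity_eq hk hlam hq hqa).symm

theorem tendstoLocallyUniformly_dunklNormalizedDensity {k lam : ℝ} (hk : 0 < k)
    (hlam : lam ≠ 0) :
    TendstoLocallyUniformly (fun (t : ℝ) (y : ℝ) => dunklNormalizedDensity k lam t y)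
      (gaussianPDFReal 0 1) atTop := by
  rw [tendstoLocallyUniformly_iff_forall_tendsto]
  intro y₀
  have hg : Continuous (gaussianPDFReal 0 1) := by unfold gaussianPDFReal; fun_prop
  exact (((hg.tendsto y₀).comp tendsto_snd).prodMk_nhds
    (tendsto_dunklNormalizedDensity hk hlam y₀)).mono_right (nhds_le_uniformity _)

/-! ### From densities to weak convergence -/

/-- Pointwise convergence of densities implies weak convergence of probability measures. -/
theorem MeasureTheory.ProbabilityMeasure.tendsto_of_tendsto_withDensity
    {E ι : Type*} [MeasurableSpace E] [TopologicalSpace E] [HasOuterApproxClosed E]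
    [BorelSpace E] {ν : Measure E} {L : Filter ι} [L.IsCountablyGenerated]
    {μs : ι → ProbabilityMeasure E} {μ : ProbabilityMeasure E} {f : ι → E → ℝ≥0∞} {g : E → ℝ≥0∞}
    (hf : ∀ i, Measurable (f i)) (hμs : ∀ᶠ i in L, (μs i : Measure E) = ν.withDensity (f i))
    (hμ : (μ : Measure E) = ν.withDensity g)
    (h : ∀ x, Tendsto (fun i => f i x) L (𝓝 (g x))) : Tendsto μs L (𝓝 μ) := by
  rcases L.eq_or_neBot with rfl | hL
  · exact tendsto_bot
  -- By the portmanteau theorem, lower bounds on open sets suffice, and Fatou's lemma supplies them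
  -- without a dominating function.
  refine tendsto_of_forall_isOpen_le_liminf' fun G hG => ?_
  rw [hμ, withDensity_apply _ hG.measurableSet]
  calc ∫⁻ x in G, g x ∂ν = ∫⁻ x in G, liminf (fun i => f i x) L ∂ν := by
        simp only [(h _).liminf_eq]
    _ ≤ liminf (fun i => ∫⁻ x in G, f i x ∂ν) L := lintegral_liminf_le hf
    _ = liminf (fun i => (μs i : Measure E) G) L := by
        refine liminf_congr ?_
        filter_upwards [hμs] with i hi
        rw [hi, withDensity_apply _ hG.measurableSet]

/-! ### The law of the process at a fixed time -/

theorem withDensity_map_sub_div (f : ℝ → ℝ≥0∞) (b : ℝ) {s : ℝ} (hs : 0 < s) :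
    (volume.withDensity f).map (fun x => (x - b) / s)
      = volume.withDensity fun y => ENNReal.ofReal s * f (y * s + b) := by
  ext A hA
  have hm : Measurable fun x : ℝ => (x - b) / s := by fun_prop
  have hpre : (fun x : ℝ => (x - b) / s) ⁻¹' A = (fun y => y * s + b) '' A := by
    ext x
    constructor
    · intro hx
      exact ⟨_, hx, by field_simp; ring⟩
    · rintro ⟨y, hy, rfl⟩
      simpa [hs.ne'] using hy
  rw [Measure.map_apply hm hA, withDensity_apply _ (hm hA), withDensity_apply _ hA, hpre,
    lintegral_image_eq_lintegral_abs_deriv_mul hA (f' := fun _ => s)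
      (fun y _ => by simpa using (((hasDerivAt_id y).mul_const s).add_const b).hasDerivWithinAt)
      (fun y _ z _ h => by simpa [hs.ne'] using h)]
  simp only [abs_of_pos hs]

/-- Take expectations in the Markov property at `s = 0`: the right side is almost surely constant
because `X 0 = x₀` almost surely. -/
theorem IsDunklProcess.map_eq_dunklTransition {Ω : Type*} [MeasurableSpace Ω] {P : Measure Ω}
    [IsProbabilityMeasure P] {k lam x₀ : ℝ} {X : ℝ≥0 → Ω → ℝ} (hX : IsDunklProcess P k lam x₀ X)
    {t : ℝ≥0} (ht : 0 < t) : P.map (X t) = dunklTransition k lam t x₀ := by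
  have hreal : ∀ A, MeasurableSet A → P.real (X t ⁻¹' A) = (dunklTransition k lam t x₀).real A := by
    intro A hA
    have hm : MeasurableSet (X t ⁻¹' A) := hX.measurable t hA
    have h := integral_condExp (μ := P)
      (f := (X t ⁻¹' A).indicator (fun _ => (1 : ℝ)))
      ((Filtration.natural X fun u => (hX.measurable u).stronglyMeasurable).le 0)
    rw [integral_congr_ae (hX.markov 0 t ht A hA), integral_indicator_const _ hm, smul_eq_mul,
      mul_one] at h
    rw [← h]
    have h0 : (fun ω => (dunklTransition k lam ((t : ℝ) - ((0 : ℝ≥0) : ℝ)) (X 0 ω) A).toReal)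
        =ᵐ[P] fun _ => (dunklTransition k lam t x₀ A).toReal := by
      filter_upwards [hX.start] with ω hω
      rw [hω, NNReal.coe_zero, sub_zero]
    rw [integral_congr_ae h0]
    simp [Measure.real]
  -- Equality of real values says nothing where a measure is infinite. Infinite total mass would
  -- have `toReal` equal to `0`, contradicting `P univ = 1`.
  have hfin : IsFiniteMeasure (dunklTransition k lam t x₀) := by
    constructor
    rw [lt_top_iff_ne_top]
    intro htop
    have h := hreal Set.univ MeasurableSet.univ
    simp [Measure.real, htop] at h
  ext A hA
  rw [Measure.map_apply (hX.measurable t) hA, ← measureReal_eq_measureReal_iff, hreal A hA]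

theorem dunklKernelReal_zero_left {k : ℝ} (hk : 0 ≤ k) (y : ℝ) : dunklKernelReal k 0 y = 1 := by
  have h := (isDunklEigenfunction_dunklKernel hk (y : ℂ)).at_zero
  rw [dunklKernelReal, Complex.ofReal_zero, h, Complex.one_re]

/-- Both kernels with first argument `0` equal `1`, and the Jacobian `√t` turns `t^(k + 1/2)` into
`t^k`. -/
theorem sqrt_mul_dunklTransitionDensity_zero {k : ℝ} (hk : 0 ≤ k) (lam : ℝ) {t : ℝ} (ht : 0 < t)
    (y : ℝ) : √t * dunklTransitionDensity k lam t 0 (y * √t + t * lam)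
      = dunklNormalizedDensity k lam t y := by
  rw [dunklTransitionDensity, dunklNormalizedDensity, zero_div, dunklKernelReal_zero_left hk,
    dunklKernelReal_zero_left hk, mul_comm t lam, Real.rpow_add ht, ← Real.sqrt_eq_rpow,
    zero_pow two_ne_zero, zero_add, one_mul, div_one]
  have : 0 < √t := Real.sqrt_pos.mpr ht
  have : 0 < t ^ k := Real.rpow_pos_of_pos ht k
  field_simp

theorem IsDunklProcess.map_normalized {Ω : Type*} [MeasurableSpace Ω] {P : Measure Ω}
    [IsProbabilityMeasure P] {k lam : ℝ} (hk : 0 ≤ k) {X : ℝ≥0 → Ω → ℝ}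
    (hX : IsDunklProcess P k lam 0 X) {t : ℝ≥0} (ht : 0 < t) :
    P.map (fun ω => (X t ω - (t : ℝ) * lam) / √(t : ℝ))
      = volume.withDensity
          (fun y : ℝ => ENNReal.ofReal (dunklNormalizedDensity k lam (t : ℝ) y)) := by
  have ht' : (0 : ℝ) < t := ht
  have hs : 0 < √(t : ℝ) := Real.sqrt_pos.mpr ht'
  have hm : Measurable fun x : ℝ => (x - t * lam) / √(t : ℝ) := by fun_prop
  have h := Measure.map_map (μ := P) hm (hX.measurable t)
  rw [hX.map_eq_dunklTransition ht, dunklTransition, withDensity_map_sub_div _ _ hs] at h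
  simp only [← ENNReal.ofReal_mul hs.le, sqrt_mul_dunklTransitionDensity_zero hk lam ht'] at h
  exact h.symm

theorem measurable_dunklNormalizedDensity {k : ℝ} (hk : 0 ≤ k) (lam t : ℝ) :
    Measurable (dunklNormalizedDensity k lam t) := by
  have hE : Continuous fun x : ℝ => dunklKernelReal k x lam :=
    Complex.continuous_re.comp
      ((isDunklEigenfunction_dunklKernel hk (lam : ℂ)).entire.continuous.comp
        Complex.continuous_ofReal)
  have hE' : Measurable fun y : ℝ => dunklKernelReal k (y * √t + lam * t) lam :=
    hE.measurable.comp (by fun_prop)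
  unfold dunklNormalizedDensity
  fun_prop

theorem mainTheorem10 {Ω : Type*} [MeasurableSpace Ω] (P : Measure Ω) [IsProbabilityMeasure P]
    (k lam : ℝ) (hk : 0 < k) (hlam : lam ≠ 0) (X : ℝ≥0 → Ω → ℝ)
    (hX : IsDunklProcess P k lam 0 X) :
    TendstoInDistribution (fun (t : ℝ≥0) (ω : Ω) => (X t ω - (t : ℝ) * lam) / √(t : ℝ)) atTop
        (id : ℝ → ℝ) (fun _ => P) (gaussianReal 0 1)
      ∧ (∀ t : ℝ≥0, 0 < t →
          P.map (fun ω => (X t ω - (t : ℝ) * lam) / √(t : ℝ))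
            = volume.withDensity
                (fun y : ℝ => ENNReal.ofReal (dunklNormalizedDensity k lam (t : ℝ) y)))
      ∧ TendstoLocallyUniformly (fun (t : ℝ) (y : ℝ) => dunklNormalizedDensity k lam t y)
          (gaussianPDFReal 0 1) atTop := by
  have hm : ∀ t : ℝ≥0, Measurable fun ω => (X t ω - (t : ℝ) * lam) / √(t : ℝ) :=
    fun t => ((hX.measurable t).sub_const _).div_const _
  refine ⟨⟨fun t => (hm t).aemeasurable, aemeasurable_id, ?_⟩,
    fun t ht => hX.map_normalized hk.le ht,
    tendstoLocallyUniformly_dunklNormalizedDensity hk hlam⟩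
  refine ProbabilityMeasure.tendsto_of_tendsto_withDensity (ν := volume)
    (f := fun t y => ENNReal.ofReal (dunklNormalizedDensity k lam (t : ℝ) y))
    (g := gaussianPDF 0 1) (fun t => (measurable_dunklNormalizedDensity hk.le lam t).ennreal_ofReal)
    ?_ ?_ fun y => ?_
  -- At `t = 0` division by `√0` gives the constant `0`, whose law has no density, so the formula is
  -- used only eventually.
  · filter_upwards [eventually_gt_atTop 0] with t ht
    exact hX.map_normalized hk.le ht
  · rw [ProbabilityMeasure.coe_mk, Measure.map_id, gaussianReal_of_var_ne_zero _ one_ne_zero]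
  · have hpair : Tendsto (fun t : ℝ≥0 => ((t : ℝ), y)) atTop (atTop ×ˢ 𝓝 y) :=
      (NNReal.tendsto_coe_atTop.mpr tendsto_id).prodMk tendsto_const_nhds
    have h := (tendsto_dunklNormalizedDensity hk hlam y).comp hpair
    simp only [Function.comp_def] at h
    exact ENNReal.tendsto_ofReal h
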